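/- Let $n\ge r\ge 1$ be integers and write $n=q_1r+r_1$ with $0\le r_1<r$. Let $\mu_{n,r}:\mathbb C^n\times\mathbb C^r\to\mathbb C^{n+r}$ be the map sending the coefficients $(a_0,\dots,a_{n-1},b_0,\dots,b_{r-1})$ of the monic polynomials $f(x)=x^n+a_{n-1}x^{n-1}+\cdots+a_0$ and $g(x)=x^r+b_{r-1}x^{r-1}+\cdots+b_0$ to the coefficients $(c_{n+r-1},\dots,c_0)$ of $f(x)g(x)=x^{n+r}+c_{n+r-1}x^{n+r-1}+\cdots+c_0$. Let $\mathcal A$ be the algebra of germs at the origin of holomorphic functions on $\mathbb C^n\times\mathbb C^r$, let $m=n+r$, and let $I(\mu_{n,r})\subset\mathcal A$ be the ideal generated by the germs of $c_{n+r-1},\dots,c_0$. For a proper ideal $J\subset\mathcal A$, let $\delta J$ be its Jacobian matrix, with rows the partial derivatives $(\partial f/\partial x_1,\dots,\partial f/\partial x_m)$ of the functions $f\in J$ with respect to the $m$ coordinates. For $k\ge 0$ let $\Delta_kJ$ be the ideal generated by $J$ and all $k\times k$ minors of $\delta J$ (so $\Delta_0J=\mathcal A$ and $\Delta_{m+1}J=J$),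 and put $\Delta^iJ=\Delta_{m-i+1}J$. The critical extension of $J$ is $\Delta_kJ$ for the least $k$ with $\Delta_kJ\neq\mathcal A$; it equals $\Delta^iJ$ with $i=m-k+1$. Set $J_0=I(\mu_{n,r})$ and, for $s\ge 1$, let $J_s=\Delta^{i_s}J_{s-1}$ be the critical extension of $J_{s-1}$. The Thom–Boardman symbol $TB(I(\mu_{n,r}))$ is the infinite sequence $(i_1,i_2,i_3,\dots)$ (trailing zeros are usually omitted). Then the $(q_1+1)$-th entry of $TB(I(\mu_{n,r}))$ is $i_{q_1+1}=r_1$. Moreover, the Jacobian matrix $\delta J_{q_1}$ of the $q_1$-th successive critical extension $J_{q_1}$ of $I(\mu_{n,r})$ has rank $n+r-r_1$ when evaluated at the origin. -/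

import Mathlib

open Filter Topology

noncomputable section

namespace ThomBoardman

section Germs

variable (ι : Type) [Fintype ι]

/-- The algebra of germs at the origin of `ℂ^ι` of holomorphic functions. (A function which is
`C^∞` over `ℂ` near a point is the same thing as a function analytic at that point.) -/
def HolGerm : Subring (Germ (𝓝 (0 : ι → ℂ)) ℂ) where
  carrier := {φ | ∃ f : (ι → ℂ) → ℂ, AnalyticAt ℂ f 0 ∧ (f : Germ (𝓝 (0 : ι → ℂ)) ℂ) = φ}
  mul_mem' := by
    rintro _ _ ⟨f, hf, rfl⟩ ⟨g, hg, rfl⟩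
    exact ⟨f * g, hf.mul hg, rfl⟩
  one_mem' := ⟨fun _ => 1, analyticAt_const, rfl⟩
  add_mem' := by
    rintro _ _ ⟨f, hf, rfl⟩ ⟨g, hg, rfl⟩
    exact ⟨f + g, hf.add hg, rfl⟩
  zero_mem' := ⟨fun _ => 0, analyticAt_const, rfl⟩
  neg_mem' := by
    rintro _ ⟨f, hf, rfl⟩
    exact ⟨-f, hf.neg, rfl⟩

variable {ι}

/-- The germ at the origin of a function that is analytic there. -/
def HolGerm.mk (f : (ι → ℂ) → ℂ) (hf : AnalyticAt ℂ f 0) : HolGerm ι :=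
  ⟨(f : Germ (𝓝 (0 : ι → ℂ)) ℂ), f, hf, rfl⟩

/-- The value of a germ at the origin. -/
def evalZero (φ : HolGerm ι) : ℂ := φ.1.value

/-- The partial derivative `∂φ/∂x_i` of a germ: the germ of
`x ↦ (d/dt) f (x + t e_i)` at `t = 0`, for any representative `f` of `φ`. -/
def partialDeriv [DecidableEq ι] (i : ι) (φ : HolGerm ι) : HolGerm ι :=
  ⟨Germ.map' (fun (f : (ι → ℂ) → ℂ) (x : ι → ℂ) => fderiv ℂ f x (Pi.single i 1))
    (fun f g (h : f =ᶠ[𝓝 0] g) => show _ =ᶠ[𝓝 0] _ by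
      filter_upwards [h.fderiv (𝕜 := ℂ)] with x hx using by rw [hx]) φ.1, by
    obtain ⟨_, f, hf, rfl⟩ := φ
    exact ⟨fun x => fderiv ℂ f x (Pi.single i 1),
      (ContinuousLinearMap.apply ℂ ℂ (Pi.single i (1 : ℂ) : ι → ℂ)).analyticAt _ |>.comp hf.fderiv,
      rfl⟩⟩

/-- The Jacobian matrix `δJ` of an ideal of germs: its rows are indexed by all the
functions `f` in `J`, its columns by the coordinates, and its entries are `∂f/∂x_i`. -/
def jacobian [DecidableEq ι] (J : Ideal (HolGerm ι)) : Matrix J ι (HolGerm ι) :=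
  Matrix.of fun f i => partialDeriv i f.1

/-- The rank of `δJ` evaluated at the origin. -/
def jacobianRankAtZero [DecidableEq ι] (J : Ideal (HolGerm ι)) : ℕ :=
  ((jacobian J).map evalZero).rank

/-- The Jacobian extension `Δ_k J`: the ideal spanned by `J` and all minors of order `k` of
the Jacobian matrix of `J`. (The empty minor is `1`, so `Δ_0 J` is the whole algebra, and
`Δ_k J = J` when `k` exceeds the number of coordinates.) -/
def jacobianExt [DecidableEq ι] (k : ℕ) (J : Ideal (HolGerm ι)) : Ideal (HolGerm ι) :=
  J ⊔ Ideal.span {d | ∃ (rows : Fin k → J) (cols : Fin k → ι),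
    d = ((jacobian J).submatrix rows cols).det}

/-- The order of the critical Jacobian extension of a proper ideal: the least order `k` of minors
for which `Δ_k J` is not the whole algebra. -/
def criticalOrder [DecidableEq ι] (J : Ideal (HolGerm ι)) : ℕ :=
  sInf {k | jacobianExt k J ≠ ⊤}

/-- The critical extension of `J`. -/
def criticalExt [DecidableEq ι] (J : Ideal (HolGerm ι)) : Ideal (HolGerm ι) :=
  jacobianExt (criticalOrder J) J

/-- The upper index `i` of the critical extension `Δ^i J = Δ_{m-i+1} J`, where `m` is the number of
coordinates. -/
def criticalIndex [DecidableEq ι] (J : Ideal (HolGerm ι)) : ℕ :=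
  Fintype.card ι + 1 - criticalOrder J

/-- The Thom-Boardman symbol of `J` as an infinite sequence: the entry with (zero-based) number
`s` is the upper index of the critical extension of the `s`-fold critical extension of `J`. -/
def TB [DecidableEq ι] (J : Ideal (HolGerm ι)) (s : ℕ) : ℕ :=
  criticalIndex (criticalExt^[s] J)

end Germs

section Multiplication

open Polynomial

/-- The monic polynomial `x^n + a_{n-1} x^{n-1} + ⋯ + a_0`. -/
def monicPoly {n : ℕ} (a : Fin n → ℂ) : ℂ[X] := X ^ n + ∑ i : Fin n, C (a i) * X ^ (i : ℕ)

/-- The multiplication map `μ_{n,r} : ℂ^n × ℂ^r → ℂ^{n+r}`, sending the lower coefficients of two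
monic polynomials of degrees `n` and `r` to those of their product. A point of `ℂ^n × ℂ^r` is
given by its coordinates `a_i = p (Sum.inl i)` and `b_j = p (Sum.inr j)`. -/
def mulMap (n r : ℕ) (p : Fin n ⊕ Fin r → ℂ) : Fin (n + r) → ℂ := fun j =>
  (monicPoly (fun i => p (Sum.inl i)) * monicPoly (fun i => p (Sum.inr i))).coeff j

theorem analyticAt_mulMap (n r : ℕ) (j : Fin (n + r)) :
    AnalyticAt ℂ (fun p => mulMap n r p j) 0 := by
  have key : ∀ (m : ℕ) (e : Fin m → Fin n ⊕ Fin r) (k : ℕ),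
      AnalyticAt ℂ (fun p : Fin n ⊕ Fin r → ℂ => (monicPoly (fun i => p (e i))).coeff k) 0 := by
    intro m e k
    simp only [monicPoly, coeff_add, finsetSum_coeff, coeff_C_mul]
    refine analyticAt_const.add (Finset.analyticAt_fun_sum _ fun i _ => ?_)
    exact ((ContinuousLinearMap.proj (R := ℂ) (φ := fun _ : Fin n ⊕ Fin r => ℂ)
      (e i)).analyticAt 0).mul analyticAt_const
  simp only [mulMap, coeff_mul]
  exact Finset.analyticAt_fun_sum _ fun x _ => (key n Sum.inl x.1).mul (key r Sum.inr x.2)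

/-- The ideal `I(μ_{n,r})` generated by the germs at the origin of the components `c_j` of the
multiplication map. -/
def mulIdeal (n r : ℕ) : Ideal (HolGerm (Fin n ⊕ Fin r)) :=
  Ideal.span (Set.range fun j : Fin (n + r) =>
    HolGerm.mk (fun p => mulMap n r p j) (analyticAt_mulMap n r j))

end Multiplication

end ThomBoardman

end

noncomputable section

namespace ThomBoardman

/-! ### Germs at the origin: units, partial derivatives, vector fields -/

section GermCalculus

variable {ι : Type} [Fintype ι]

/-! Expand f in base g: put H_0 = f and divide repeatedly, H_s = R_s + g H_{s+1}. As long as s r ≤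
n, J_s is generated by the coefficients of R_0, …, R_{s-1} and the non-leading coefficients of
g^(s+1) H_s (`iterate_criticalExt_mulIdeal`).

A vector field can prescribe the derivatives of g, H_s and R_0, …, R_{s-1} independently
(`exists_vectorField`). If it sends g to u and H_s to v, it sends g^(s+1) H_s to g^s ((s+1) u H_s +
g v). While (s+1) r ≤ n, take u = X^a with a < r and let v cancel the quotient of u H_s by g; what
remains is (s+1) g^s (X^a R_s mod g). This vanishes at the origin because R_s does, so these r
fields span the kernel of the Jacobian matrix there. The critical minors then amount to derivatives
along these fields (`IsFrame.jacobianExt_eq`). The case a = 0 gives g^s R_s, and g is monic, so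
exactly the coefficients of R_s are adjoined (`criticalExt_digitIdeal`).

For s = q₁ the degree of H_s is r₁ < r. At the origin the derivative becomes X^(rs) ((s+1) u X^r₁ +
X^r v), which vanishes on an r₁-dimensional space of pairs (u, v); this corank is the entry of the
symbol (`exists_isFrame_of_remainder`). -/

theorem HolGerm.exists_mk (φ : HolGerm ι) : ∃ f hf, φ = HolGerm.mk f hf := by
  obtain ⟨_, f, hf, rfl⟩ := φ
  exact ⟨f, hf, rfl⟩

/-- Evaluation at the origin as a ring homomorphism. -/
def evalHom (ι : Type) [Fintype ι] : HolGerm ι →+* ℂ :=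
  Germ.valueRingHom.comp (HolGerm ι).subtype

theorem evalHom_mk (f : (ι → ℂ) → ℂ) (hf : AnalyticAt ℂ f 0) :
    evalHom ι (HolGerm.mk f hf) = f 0 := rfl

theorem isUnit_of_evalHom_ne_zero {φ : HolGerm ι} (h : evalHom ι φ ≠ 0) : IsUnit φ := by
  obtain ⟨f, hf, rfl⟩ := HolGerm.exists_mk φ
  rw [evalHom_mk] at h
  refine IsUnit.of_mul_eq_one (HolGerm.mk f⁻¹ (hf.inv h)) (Subtype.ext ?_)
  change ((f * f⁻¹ : (ι → ℂ) → ℂ) : Germ (𝓝 (0 : ι → ℂ)) ℂ) = ((1 : (ι → ℂ) → ℂ) : Germ _ ℂ)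
  refine Germ.coe_eq.2 ?_
  filter_upwards [hf.continuousAt.eventually_ne h] with x hx
  simp [hx]

theorem ideal_eq_top_iff {J : Ideal (HolGerm ι)} : J = ⊤ ↔ ∃ φ ∈ J, evalHom ι φ ≠ 0 := by
  constructor
  · rintro rfl
    exact ⟨1, trivial, by simp⟩
  · rintro ⟨φ, hφ, h⟩
    exact Ideal.eq_top_of_isUnit_mem _ hφ (isUnit_of_evalHom_ne_zero h)

theorem isUnit_natCast_succ (s : ℕ) : IsUnit ((s + 1 : ℕ) : HolGerm ι) := by
  apply isUnit_of_evalHom_ne_zero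
  rw [map_natCast]
  exact_mod_cast s.succ_ne_zero

/-- The germ of a coordinate function. -/
def coordGerm (i : ι) : HolGerm ι :=
  HolGerm.mk (fun p => p i)
    ((ContinuousLinearMap.proj (R := ℂ) (φ := fun _ : ι => ℂ) i).analyticAt 0)

theorem evalHom_coordGerm (i : ι) : evalHom ι (coordGerm i) = 0 := rfl

variable [DecidableEq ι]

theorem partialDeriv_add (i : ι) (φ ψ : HolGerm ι) :
    partialDeriv i (φ + ψ) = partialDeriv i φ + partialDeriv i ψ := by
  obtain ⟨f, hf, rfl⟩ := HolGerm.exists_mk φ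
  obtain ⟨g, hg, rfl⟩ := HolGerm.exists_mk ψ
  refine Subtype.ext (Germ.coe_eq.2 ?_)
  filter_upwards [hf.eventually_analyticAt, hg.eventually_analyticAt] with x hfx hgx
  exact congrArg (· (Pi.single i 1)) (fderiv_add hfx.differentiableAt hgx.differentiableAt)

theorem partialDeriv_mul (i : ι) (φ ψ : HolGerm ι) :
    partialDeriv i (φ * ψ) = φ * partialDeriv i ψ + ψ * partialDeriv i φ := by
  obtain ⟨f, hf, rfl⟩ := HolGerm.exists_mk φ
  obtain ⟨g, hg, rfl⟩ := HolGerm.exists_mk ψ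
  refine Subtype.ext (Germ.coe_eq.2 ?_)
  filter_upwards [hf.eventually_analyticAt, hg.eventually_analyticAt] with x hfx hgx
  exact congrArg (· (Pi.single i 1)) (fderiv_mul hfx.differentiableAt hgx.differentiableAt)

theorem partialDeriv_coordGerm (i j : ι) :
    partialDeriv i (coordGerm j) = if j = i then 1 else 0 := by
  have h : ∀ x, fderiv ℂ (fun p : ι → ℂ => p j) x (Pi.single i 1) = if j = i then 1 else 0 := by
    intro x
    rw [show (fun p : ι → ℂ => p j) = ContinuousLinearMap.proj (R := ℂ) (φ := fun _ : ι => ℂ) j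
      from rfl, ContinuousLinearMap.fderiv]
    simp [Pi.single_apply]
  refine Subtype.ext ((Germ.coe_eq.2 (Eventually.of_forall h)).trans ?_)
  split_ifs <;> rfl

/-- The vector field `∑ i, c i ∂/∂x_i` as a derivation of the algebra of germs. -/
def vectorField (c : ι → HolGerm ι) : Derivation ℤ (HolGerm ι) (HolGerm ι) :=
  Derivation.mk' (AddMonoidHom.toIntLinearMap
    { toFun := fun φ => ∑ i, c i * partialDeriv i φ
      map_zero' := by
        have h (i : ι) : partialDeriv i (0 : HolGerm ι) = 0 := by
          simpa using partialDeriv_add i (0 : HolGerm ι) 0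
        simp [h]
      map_add' := fun φ ψ => by
        simp only [partialDeriv_add, mul_add, Finset.sum_add_distrib] }) fun φ ψ => by
    simp only [AddMonoidHom.coe_toIntLinearMap, AddMonoidHom.coe_mk, ZeroHom.coe_mk,
      partialDeriv_mul, smul_eq_mul, Finset.mul_sum, ← Finset.sum_add_distrib]
    exact Finset.sum_congr rfl fun i _ => by ring

theorem vectorField_apply (c : ι → HolGerm ι) (φ : HolGerm ι) :
    vectorField c φ = ∑ i, c i * partialDeriv i φ := rfl

theorem vectorField_coordGerm (c : ι → HolGerm ι) (j : ι) :
    vectorField c (coordGerm j) = c j := by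
  simp [vectorField_apply, partialDeriv_coordGerm]

end GermCalculus

/-! ### Determinants of products over a commutative ring -/

section Minors

open Matrix

/-- Embedding the inner index set into the outer one turns the product into one of square matrices,
the second having a zero row. This avoids rank arguments, since `R` will be a quotient ring. -/
theorem det_mul_eq_zero_of_card_lt {R κ ν : Type*} [CommRing R] [Fintype κ] [Fintype ν]
    [DecidableEq ν] (h : Fintype.card κ < Fintype.card ν) (M : Matrix ν κ R) (N : Matrix κ ν R) :
    (M * N).det = 0 := by
  classical
  obtain ⟨e⟩ : Nonempty (κ ↪ ν) := Function.Embedding.nonempty_of_card_le h.le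
  obtain ⟨a, ha⟩ : ∃ a, a ∉ Set.range e := by
    by_contra! hs
    exact h.not_ge (Fintype.card_le_of_surjective e hs)
  let P : Matrix κ ν R := Matrix.of fun k j => if e k = j then 1 else 0
  have hP : P * Pᵀ = 1 := by
    ext k l
    simp [P, Matrix.mul_apply, Matrix.one_apply, eq_comm]
  have hM : M * N = (M * P) * (Pᵀ * N) := by
    rw [Matrix.mul_assoc, ← Matrix.mul_assoc P, hP, Matrix.one_mul]
  rw [hM, det_mul, det_eq_zero_of_row_eq_zero (A := Pᵀ * N) a, mul_zero]
  intro j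
  refine Finset.sum_eq_zero fun k _ => ?_
  change (if e k = a then (1 : R) else 0) * _ = 0
  rw [if_neg fun hk => ha ⟨k, hk⟩, zero_mul]

/-- The determinant of `M * N` lies in the ideal generated by the maximal minors of `M`. -/
theorem det_mul_mem_of_minors {R ν ι : Type*} [CommRing R] [Fintype ι] [Fintype ν]
    [DecidableEq ν] (K : Ideal R) (M : Matrix ν ι R) (N : Matrix ι ν R)
    (h : ∀ cols : ν → ι, (M.submatrix id cols).det ∈ K) : (M * N).det ∈ K := by
  classical
  have e : (M * N)ᵀ = fun j => ∑ i, N i j • Mᵀ i := by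
    ext j k
    simp [Matrix.mul_apply, Finset.sum_apply, mul_comm]
  rw [← det_transpose, e]
  change (detRowAlternating (R := R) (n := ν)).toMultilinearMap _ ∈ K
  rw [MultilinearMap.map_sum]
  refine K.sum_mem fun cols _ => ?_
  rw [MultilinearMap.map_smul_univ]
  refine K.mul_mem_left _ ?_
  have := h cols
  rwa [← det_transpose] at this

end Minors

/-! ### Frames adapted to an ideal, and the critical extension in terms of them -/

section Frames

open Matrix

variable {ι κ α : Type} [Fintype ι] [DecidableEq ι] [Fintype κ] [DecidableEq κ] [Fintype α]
  [DecidableEq α]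

/-- Vector fields `φ`, `θ` and germs `f`, `y` such that the `f j` belong to `J` and are dual
to the `φ i` at the origin, where the `θ a` are dual to the `y b` and annihilate `J`. -/
structure IsFrame (J : Ideal (HolGerm ι)) (φ : κ → ι → HolGerm ι) (θ : α → ι → HolGerm ι)
    (f : κ → HolGerm ι) (y : α → HolGerm ι) : Prop where
  card : Fintype.card κ + Fintype.card α = Fintype.card ι
  mem : ∀ j, f j ∈ J
  normal : ∀ i j, evalHom ι (vectorField (φ i) (f j)) = if i = j then 1 else 0
  tangent : ∀ a, ∀ g ∈ J, evalHom ι (vectorField (θ a) g) = 0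
  dual : ∀ a b, evalHom ι (vectorField (θ a) (y b)) = if a = b then 1 else 0

/-- A derivation along a vector field has the value prescribed by the Jacobian matrix. -/
theorem evalHom_vectorField (c : ι → HolGerm ι) (g : HolGerm ι) :
    evalHom ι (vectorField c g) =
      ∑ i, evalHom ι (partialDeriv i g) * evalHom ι (c i) := by
  simp [vectorField_apply, mul_comm]

/-- The matrix is the Jacobian matrix of the `f j` times the matrix of components of the fields, so
its determinant is a combination of minors. -/
theorem det_vectorField_mem {ν : Type} [Fintype ν] [DecidableEq ν] (J : Ideal (HolGerm ι))
    (f : ν → HolGerm ι) (hf : ∀ j, f j ∈ J) (c : ν → ι → HolGerm ι) :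
    (Matrix.of fun j i => vectorField (c i) (f j)).det ∈ jacobianExt (Fintype.card ν) J := by
  have e := Fintype.equivFin ν
  have h : (Matrix.of fun j i => vectorField (c i) (f j)) =
      (Matrix.of fun j i => partialDeriv i (f j)) * (Matrix.of fun i j => c j i) := by
    ext1 j i
    simp [vectorField_apply, Matrix.mul_apply, mul_comm]
  rw [h]
  refine det_mul_mem_of_minors _ _ _ fun cols => ?_
  rw [← det_submatrix_equiv_self e.symm]
  exact Ideal.mem_sup_right (Ideal.subset_span
    ⟨fun k => ⟨f (e.symm k), hf _⟩, fun k => cols (e.symm k), rfl⟩)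

variable {J : Ideal (HolGerm ι)} {φ : κ → ι → HolGerm ι} {θ : α → ι → HolGerm ι}
  {f : κ → HolGerm ι} {y : α → HolGerm ι}

theorem jacobian_mulVec (c : ι → HolGerm ι) (g : J) :
    (((jacobian J).map evalZero) *ᵥ fun i => evalHom ι (c i)) g =
      evalHom ι (vectorField c g.1) := by
  rw [evalHom_vectorField]
  rfl

/-- The `φ` have independent images and the `θ` are independent in the kernel. Their numbers add up
to the dimension, so rank-nullity turns both lower bounds into equalities. -/
theorem IsFrame.jacobianRankAtZero_eq (h : IsFrame J φ θ f y) :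
    jacobianRankAtZero J = Fintype.card κ := by
  set L := ((jacobian J).map evalZero).mulVecLin with hL
  have hrank : jacobianRankAtZero J = Module.finrank ℂ (LinearMap.range L) := rfl
  have hrn := LinearMap.finrank_range_add_finrank_ker L
  rw [Module.finrank_fintype_fun_eq_card, ← h.card] at hrn
  have h1 : Fintype.card κ ≤ Module.finrank ℂ (LinearMap.range L) := by
    let v : κ → LinearMap.range L := fun i => ⟨L fun k => evalHom ι (φ i k), _, rfl⟩
    refine LinearIndependent.fintype_card_le_finrank (b := v) ?_
    rw [Fintype.linearIndependent_iff]
    intro g hg j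
    have := congrFun (congrArg Subtype.val hg) ⟨f j, h.mem j⟩
    simp only [v, Submodule.coe_sum, Submodule.coe_smul, Finset.sum_apply, Pi.smul_apply, hL,
      mulVecLin_apply, jacobian_mulVec, h.normal, smul_eq_mul] at this
    simpa using this
  have h2 : Fintype.card α ≤ Module.finrank ℂ (LinearMap.ker L) := by
    let v : α → LinearMap.ker L := fun a => ⟨fun k => evalHom ι (θ a k), by
      ext g
      rw [hL, mulVecLin_apply, jacobian_mulVec, h.tangent a g.1 g.2]
      rfl⟩
    refine LinearIndependent.fintype_card_le_finrank (b := v) ?_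
    rw [Fintype.linearIndependent_iff]
    intro g hg b
    have hg' : ∀ i, ∑ a, g a * evalHom ι (θ a i) = 0 := fun i => by
      simpa [v] using congrFun (congrArg Subtype.val hg) i
    have : ∑ a, g a * evalHom ι (vectorField (θ a) (y b)) = 0 := by
      simp only [evalHom_vectorField, Finset.mul_sum]
      rw [Finset.sum_comm]
      refine Finset.sum_eq_zero fun i _ => ?_
      rw [← mul_zero (evalHom ι (partialDeriv i (y b))), ← hg' i, Finset.mul_sum]
      exact Finset.sum_congr rfl fun a _ => by ring
    simpa [h.dual] using this
  omega

theorem IsFrame.isUnit_det (h : IsFrame J φ θ f y) :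
    IsUnit (Matrix.of fun j i => vectorField (φ i) (f j)).det := by
  apply isUnit_of_evalHom_ne_zero
  rw [RingHom.map_det]
  have : (evalHom ι).mapMatrix (Matrix.of fun j i => vectorField (φ i) (f j)) =
      Matrix.diagonal fun _ => 1 := by
    ext j i
    simp [h.normal, Matrix.diagonal_apply, eq_comm]
  rw [this, det_diagonal]
  simp

/-- Laplace expansion puts minors of order `l + 1` in the ideal of minors of order `l`. -/
theorem jacobianExt_eq_top_of_le {k l : ℕ} (hkl : k ≤ l) (hl : jacobianExt l J = ⊤) :
    jacobianExt k J = ⊤ := by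
  induction l, hkl using Nat.le_induction with
  | base => exact hl
  | succ l hkl ih =>
    refine ih (top_le_iff.1 (hl.symm.le.trans (sup_le le_sup_left (Ideal.span_le.2 ?_))))
    rintro _ ⟨rows, cols, rfl⟩
    rw [SetLike.mem_coe, det_succ_row_zero]
    refine Ideal.sum_mem _ fun j _ => Ideal.mul_mem_left _ _ ?_
    exact Ideal.mem_sup_right (Ideal.subset_span
      ⟨fun i => rows i.succ, fun i => cols (j.succAbove i), rfl⟩)

theorem IsFrame.criticalOrder_eq (h : IsFrame J φ θ f y) (hJ : J ≠ ⊤) :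
    criticalOrder J = Fintype.card κ + 1 := by
  have htop : jacobianExt (Fintype.card κ) J = ⊤ :=
    Ideal.eq_top_of_isUnit_mem _ (det_vectorField_mem J f h.mem φ) h.isUnit_det
  have hne : jacobianExt (Fintype.card κ + 1) J ≠ ⊤ := by
    intro ht
    have hle : jacobianExt (Fintype.card κ + 1) J ≤ RingHom.ker (evalHom ι) := by
      refine sup_le (fun g hg => ?_) (Ideal.span_le.2 ?_)
      · by_contra hg'
        exact hJ (ideal_eq_top_iff.2 ⟨g, hg, hg'⟩)
      · rintro _ ⟨rows, cols, rfl⟩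
        by_contra hd
        rw [SetLike.mem_coe, RingHom.mem_ker, RingHom.map_det] at hd
        have h1 := rank_of_isUnit _ ((isUnit_iff_isUnit_det _).2 (isUnit_iff_ne_zero.2 hd))
        have h2 := rank_submatrix_le ((jacobian J).map evalZero) rows cols
        have h3 : ((jacobian J).map evalZero).rank = Fintype.card κ := h.jacobianRankAtZero_eq
        have h4 : (evalHom ι).mapMatrix ((jacobian J).submatrix rows cols) =
          ((jacobian J).map evalZero).submatrix rows cols := rfl
        rw [h4] at h1
        rw [Fintype.card_fin] at h1
        omega
    have : (1 : HolGerm ι) ∈ RingHom.ker (evalHom ι) := hle (ht ▸ trivial)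
    simp at this
  refine le_antisymm (Nat.sInf_le hne) (le_csInf ⟨_, hne⟩ fun k hk => ?_)
  by_contra! hlt
  exact hk (jacobianExt_eq_top_of_le (Nat.lt_succ_iff.1 hlt) htop)

theorem IsFrame.criticalIndex_eq (h : IsFrame J φ θ f y) (hJ : J ≠ ⊤) :
    criticalIndex J = Fintype.card α := by
  rw [criticalIndex, h.criticalOrder_eq hJ, ← h.card]
  omega

/-- The coordinate derivations are combinations of the vector fields of a frame. -/
theorem IsFrame.exists_partialDeriv_eq (h : IsFrame J φ θ f y) :
    ∃ C : Matrix ι (κ ⊕ α) (HolGerm ι), ∀ i g, partialDeriv i g =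
      ∑ k, C i (.inl k) * vectorField (φ k) g + ∑ a, C i (.inr a) * vectorField (θ a) g := by
  let B : Matrix (κ ⊕ α) ι (HolGerm ι) := Matrix.of (Sum.elim φ θ)
  let Y : Matrix ι (κ ⊕ α) (HolGerm ι) := Matrix.of fun i b => partialDeriv i (Sum.elim f y b)
  have hBY (a b) : (B * Y) a b = vectorField (Sum.elim φ θ a) (Sum.elim f y b) := rfl
  have hdet : IsUnit (B * Y).det := by
    apply isUnit_of_evalHom_ne_zero
    -- Block triangular at the origin, because the `θ` annihilate the `f j`, which lie in `J`.
    have : (evalHom ι).mapMatrix (B * Y) = Matrix.fromBlocks (Matrix.diagonal fun _ => 1)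
        (Matrix.of fun k b => evalHom ι (vectorField (φ k) (y b))) 0 1 := by
      ext (k | a) (j | b)
      · simp [hBY, h.normal, Matrix.one_apply]
      · simp [hBY]
      · simp [hBY, h.tangent a _ (h.mem j)]
      · simp [hBY, h.dual, Matrix.one_apply]
    rw [RingHom.map_det, this, det_fromBlocks_zero₂₁, det_diagonal, det_one, mul_one]
    simp
  have hinv : B * (Y * (B * Y)⁻¹) = 1 := by
    rw [← Matrix.mul_assoc, mul_nonsing_inv _ hdet]
  replace hinv := (mul_eq_one_comm_of_card_eq _ _ _ (by rw [Fintype.card_sum, h.card])).1 hinv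
  refine ⟨Y * (B * Y)⁻¹, fun i g => ?_⟩
  set C := Y * (B * Y)⁻¹
  have key : ∑ b, C i b * vectorField (Sum.elim φ θ b) g = partialDeriv i g := by
    have h1 : ∀ b, vectorField (Sum.elim φ θ b) g = (B *ᵥ fun i => partialDeriv i g) b :=
      fun b => rfl
    simp only [h1]
    change (C *ᵥ (B *ᵥ fun i => partialDeriv i g)) i = _
    rw [mulVec_mulVec, hinv, one_mulVec]
  rw [← key, Fintype.sum_sum_type]
  rfl

/-- Modulo `J` and the derivatives along the `θ`, the Jacobian matrix factors through the `φ`, so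
minors of order one more than their number vanish. Conversely, bordering the invertible block of the
`φ` and `f` with one `θ a` and one `g` gives that unit times the derivative of `g`. -/
theorem IsFrame.jacobianExt_eq (h : IsFrame J φ θ f y)
    (hθ : ∀ a j, vectorField (θ a) (f j) = 0) :
    jacobianExt (Fintype.card κ + 1) J =
      J ⊔ Ideal.span {d | ∃ a, ∃ g ∈ J, d = vectorField (θ a) g} := by
  apply le_antisymm
  · refine sup_le le_sup_left (Ideal.span_le.2 ?_)
    rintro _ ⟨rows, cols, rfl⟩
    set K := J ⊔ Ideal.span {d | ∃ a, ∃ g ∈ J, d = vectorField (θ a) g}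
    obtain ⟨C, hC⟩ := h.exists_partialDeriv_eq
    rw [SetLike.mem_coe, ← Ideal.Quotient.eq_zero_iff_mem, RingHom.map_det]
    have : (Ideal.Quotient.mk K).mapMatrix ((jacobian J).submatrix rows cols) =
        (Matrix.of fun a k => Ideal.Quotient.mk K (vectorField (φ k) (rows a).1)) *
          (Matrix.of fun k b => Ideal.Quotient.mk K (C (cols b) (.inl k))) := by
      ext a b
      simp only [RingHom.mapMatrix_apply, map_apply, submatrix_apply, Matrix.mul_apply, of_apply,
        jacobian, hC (cols b), map_add, map_sum, map_mul]
      rw [add_eq_left.2]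
      · exact Finset.sum_congr rfl fun _ _ => mul_comm _ _
      · refine Finset.sum_eq_zero fun t _ => ?_
        have ht : vectorField (θ t) (rows a).1 ∈ K :=
          Ideal.mem_sup_right (Ideal.subset_span ⟨t, (rows a).1, (rows a).2, rfl⟩)
        rw [Ideal.Quotient.eq_zero_iff_mem.2 ht, mul_zero]
    rw [this]
    exact det_mul_eq_zero_of_card_lt (by simp) _ _
  · refine sup_le le_sup_left (Ideal.span_le.2 ?_)
    rintro _ ⟨a, g, hg, rfl⟩
    have hm := det_vectorField_mem J (Sum.elim f fun _ : Unit => g)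
      (by rintro (j | _); exacts [h.mem j, hg]) (Sum.elim φ fun _ => θ a)
    -- The zero block is where `hθ` enters: the `θ a` must kill the `f j` identically, not only at
    -- the origin.
    have hb : (Matrix.of fun j i => vectorField ((Sum.elim φ fun _ : Unit => θ a) i)
        ((Sum.elim f fun _ : Unit => g) j)) =
        Matrix.fromBlocks (Matrix.of fun j i => vectorField (φ i) (f j)) 0
          (Matrix.of fun _ i => vectorField (φ i) g)
          (Matrix.of fun _ _ => vectorField (θ a) g) := by
      ext1 (j | _) (i | _)
      · rfl
      · exact hθ a j
      · rfl
      · rfl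
    rw [hb, det_fromBlocks_zero₁₂, Fintype.card_sum, Fintype.card_unit, det_unique (n := Unit),
      Ideal.unit_mul_mem_iff_mem _ h.isUnit_det] at hm
    exact hm

end Frames

open Polynomial

/-! ### Polynomials with germ coefficients and derivations acting on them -/

section PolynomialGerms

variable {ι : Type} [Fintype ι]

instance : Nontrivial (HolGerm ι) := (evalHom ι).domain_nontrivial

/-- The generic monic polynomial of degree `k` whose lower coefficients are the coordinates with
labels `e i`. -/
def genericMonic {k : ℕ} (e : Fin k → ι) : (HolGerm ι)[X] :=
  X ^ k + ∑ i : Fin k, C (coordGerm (e i)) * X ^ (i : ℕ)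

theorem genericMonic_monic {k : ℕ} (e : Fin k → ι) : (genericMonic e).Monic :=
  monic_X_pow_add (degree_sum_fin_lt _)

theorem natDegree_genericMonic {k : ℕ} (e : Fin k → ι) : (genericMonic e).natDegree = k := by
  rw [genericMonic, natDegree_add_eq_left_of_degree_lt, natDegree_X_pow]
  rw [degree_X_pow]
  exact degree_sum_fin_lt _

theorem degree_genericMonic {k : ℕ} (e : Fin k → ι) : (genericMonic e).degree = k := by
  rw [degree_eq_natDegree (genericMonic_monic e).ne_zero, natDegree_genericMonic]

theorem map_genericMonic {k : ℕ} (e : Fin k → ι) :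
    (genericMonic e).map (evalHom ι) = X ^ k := by
  simp [genericMonic, Polynomial.map_sum, evalHom_coordGerm]

/-- The germs of the coefficients of the polynomials `p x` are the coefficients of `P`. -/
def Represents (P : (HolGerm ι)[X]) (p : (ι → ℂ) → ℂ[X]) : Prop :=
  ∀ j, (P.coeff j).1 = ((fun x => (p x).coeff j : (ι → ℂ) → ℂ) : Germ (𝓝 (0 : ι → ℂ)) ℂ)

theorem Represents.mul {P Q : (HolGerm ι)[X]} {p q : (ι → ℂ) → ℂ[X]} (hP : Represents P p)
    (hQ : Represents Q q) : Represents (P * Q) fun x => p x * q x := by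
  intro j
  have h : (fun x => (p x * q x).coeff j : (ι → ℂ) → ℂ) =
      ∑ k ∈ Finset.HasAntidiagonal.antidiagonal j, (fun x => (p x).coeff k.1) * fun x => (q x).coeff k.2 := by
    ext x
    simp [coeff_mul]
  rw [h, ← Germ.coe_coeRingHom, map_sum, coeff_mul, AddSubmonoidClass.coe_finsetSum]
  refine Finset.sum_congr rfl fun k _ => ?_
  rw [map_mul]
  exact congrArg₂ (· * ·) (hP k.1) (hQ k.2)

theorem represents_genericMonic {k : ℕ} (e : Fin k → ι) :
    Represents (genericMonic e) fun x => monicPoly fun i => x (e i) := by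
  intro j
  have h : (fun x => (monicPoly fun i => x (e i)).coeff j : (ι → ℂ) → ℂ) =
      (if j = k then 1 else 0) +
        ∑ i : Fin k, if j = (i : ℕ) then (fun x : ι → ℂ => x (e i)) else 0 := by
    ext x
    simp only [monicPoly, coeff_add, coeff_X_pow, finsetSum_coeff, coeff_C_mul_X_pow,
      Pi.add_apply, Finset.sum_apply]
    congr 1
    · split_ifs <;> rfl
    · exact Finset.sum_congr rfl fun i _ => by split_ifs <;> rfl
  rw [h, ← Germ.coe_coeRingHom, map_add, map_sum, genericMonic, coeff_add, finsetSum_coeff,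
    AddMemClass.coe_add, AddSubmonoidClass.coe_finsetSum]
  congr 1
  · rw [coeff_X_pow]
    split_ifs <;> simp
  · refine Finset.sum_congr rfl fun i _ => ?_
    rw [coeff_C_mul_X_pow]
    split_ifs
    · rfl
    · simp

variable [DecidableEq ι]

/-- The action of a vector field on the coefficients of a polynomial. -/
def coeffDeriv (c : ι → HolGerm ι) : Derivation ℤ (HolGerm ι)[X] (HolGerm ι)[X] :=
  letI : Differential (HolGerm ι) := ⟨vectorField c⟩
  Differential.mapCoeffs

@[simp]
theorem coeff_coeffDeriv (c : ι → HolGerm ι) (P : (HolGerm ι)[X]) (j : ℕ) :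
    (coeffDeriv c P).coeff j = vectorField c (P.coeff j) := rfl

theorem degree_coeffDeriv_lt (c : ι → HolGerm ι) {P : (HolGerm ι)[X]} {k : ℕ}
    (h : P.degree < k) : (coeffDeriv c P).degree < k := by
  rw [degree_lt_iff_coeff_zero] at h ⊢
  intro m hm
  rw [coeff_coeffDeriv, h m hm, map_zero]

theorem coeffDeriv_genericMonic (c : ι → HolGerm ι) {k : ℕ} (e : Fin k → ι) :
    coeffDeriv c (genericMonic e) = ∑ i : Fin k, C (c (e i)) * X ^ (i : ℕ) := by
  ext1 j
  simp only [coeff_coeffDeriv, genericMonic, coeff_add, coeff_X_pow, finsetSum_coeff,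
    coeff_C_mul_X_pow, map_add, map_sum]
  rw [show vectorField c (if j = k then 1 else 0) = 0 by split_ifs <;> simp, zero_add]
  refine Finset.sum_congr rfl fun i _ => ?_
  split_ifs
  · exact vectorField_coordGerm c _
  · simp

theorem coeffDeriv_pow_mul (c : ι → HolGerm ι) (s : ℕ) (G H : (HolGerm ι)[X]) :
    coeffDeriv c (G ^ (s + 1) * H) =
      G ^ s * (((s + 1 : ℕ) : (HolGerm ι)[X]) * coeffDeriv c G * H + G * coeffDeriv c H) := by
  rw [Derivation.leibniz, Derivation.leibniz_pow]
  simp only [smul_eq_mul, nsmul_eq_mul, Nat.add_sub_cancel]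
  ring

end PolynomialGerms

/-! ### Degrees and coefficients over a commutative ring -/

section PolynomialLemmas

variable {R : Type*} [CommRing R]

theorem degree_mul_lt_add {p q : R[X]} {a b : ℕ} (hp : p.degree < a) (hq : q.degree ≤ b) :
    (p * q).degree < (a + b : ℕ) := by
  by_cases h0 : p = 0
  · simp [h0]
  rw [degree_eq_natDegree h0, Nat.cast_lt] at hp
  refine (degree_mul_le p q).trans_lt ?_
  rw [degree_eq_natDegree h0]
  calc (p.natDegree : WithBot ℕ) + q.degree ≤ p.natDegree + b := by gcongr
    _ < (a + b : ℕ) := by exact_mod_cast Nat.add_lt_add_right hp b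

theorem map_mk_eq_zero_iff {K : Ideal R} {p : R[X]} :
    p.map (Ideal.Quotient.mk K) = 0 ↔ ∀ l, p.coeff l ∈ K := by
  simp [Polynomial.ext_iff, Ideal.Quotient.eq_zero_iff_mem]

theorem sum_fin_C_coeff_mul_X_pow {p : R[X]} {k : ℕ} (h : p.degree < k) :
    ∑ i : Fin k, C (p.coeff i) * X ^ (i : ℕ) = p := by
  rw [degree_lt_iff_coeff_zero] at h
  rw [Fin.sum_univ_eq_sum_range (fun i => C (p.coeff i) * X ^ i)]
  ext j
  simp only [finsetSum_coeff, coeff_C_mul_X_pow, Finset.sum_ite_eq, Finset.mem_range]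
  split_ifs with hj
  · rfl
  · exact (h j (not_lt.1 hj)).symm

end PolynomialLemmas

/-! ### Base-`g` digits of `f` as new coordinates -/

section EuclideanData

variable (n r : ℕ)

/-- The polynomial `f` with generic coefficients. -/
def genericF : (HolGerm (Fin n ⊕ Fin r))[X] := genericMonic Sum.inl

/-- The polynomial `g` with generic coefficients. -/
def genericG : (HolGerm (Fin n ⊕ Fin r))[X] := genericMonic Sum.inr

/-- The iterated quotients of `f` by `g`. -/
def quot : ℕ → (HolGerm (Fin n ⊕ Fin r))[X]
  | 0 => genericF n r
  | s + 1 => quot s /ₘ genericG n r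

/-- The successive remainders of `f` by `g`, which are the digits of `f` in base `g`. -/
def rem (s : ℕ) : (HolGerm (Fin n ⊕ Fin r))[X] := quot n r s %ₘ genericG n r

/-- The ideal of the coefficients of the first `s` remainders and of `g ^ (s + 1)` times the `s`-th
quotient. -/
def digitIdeal (s : ℕ) : Ideal (HolGerm (Fin n ⊕ Fin r)) :=
  Ideal.span ({d | ∃ i < s, ∃ l, d = (rem n r i).coeff l} ∪
    {d | ∃ l < n + r, d = (genericG n r ^ (s + 1) * quot n r s).coeff l})

theorem mulIdeal_eq_digitIdeal : mulIdeal n r = digitIdeal n r 0 := by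
  have h := (represents_genericMonic (Sum.inl : Fin n → Fin n ⊕ Fin r)).mul
    (represents_genericMonic Sum.inr)
  rw [mulIdeal, digitIdeal]
  congr 1
  ext d
  simp only [Set.mem_range, Set.mem_union, Set.mem_ofPred_eq, not_lt_zero, false_and, exists_false,
    false_or, zero_add, pow_one]
  constructor
  · rintro ⟨l, rfl⟩
    refine ⟨l, l.2, Subtype.ext ?_⟩
    rw [mul_comm]
    exact (h l).symm
  · rintro ⟨l, hl, rfl⟩
    refine ⟨⟨l, hl⟩, Subtype.ext ?_⟩
    rw [mul_comm]
    exact (h l).symm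

theorem genericG_monic : (genericG n r).Monic := genericMonic_monic _

theorem degree_genericG : (genericG n r).degree = r := degree_genericMonic _

theorem natDegree_genericG : (genericG n r).natDegree = r := natDegree_genericMonic _

theorem quot_eq (s : ℕ) : quot n r s = rem n r s + genericG n r * quot n r (s + 1) :=
  (modByMonic_add_div _ _).symm

theorem degree_rem_lt (s : ℕ) : (rem n r s).degree < r := by
  rw [← degree_genericG n r]
  exact degree_modByMonic_lt _ (genericG_monic n r)

theorem natDegree_quot (s : ℕ) : (quot n r s).natDegree = n - s * r := by
  induction s with
  | zero => rw [quot, genericF, natDegree_genericMonic, zero_mul, Nat.sub_zero]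
  | succ s ih =>
    rw [quot, natDegree_divByMonic _ (genericG_monic n r), ih, natDegree_genericG, Nat.sub_sub,
      Nat.succ_mul]

theorem map_quot {s : ℕ} (hs : s * r ≤ n) :
    (quot n r s).map (evalHom _) = X ^ (n - s * r) := by
  induction s with
  | zero => rw [quot, genericF, map_genericMonic, zero_mul, Nat.sub_zero]
  | succ s ih =>
    rw [Nat.succ_mul] at hs
    rw [quot, map_divByMonic _ (genericG_monic n r), ih (by omega), genericG, map_genericMonic,
      show n - s * r = r + (n - (s + 1) * r) by rw [Nat.succ_mul]; omega, pow_add,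
      mul_divByMonic_cancel_left _ (monic_X_pow r)]

theorem map_genericG : (genericG n r).map (evalHom _) = X ^ r := map_genericMonic _

theorem map_rem {s : ℕ} (hs : (s + 1) * r ≤ n) : (rem n r s).map (evalHom _) = 0 := by
  have h := congrArg (Polynomial.map (evalHom _)) (quot_eq n r s)
  have hs' : s * r + r ≤ n := by rwa [← Nat.succ_mul]
  rw [Polynomial.map_add, Polynomial.map_mul, map_quot n r hs, map_quot n r (by omega : s * r ≤ n),
    map_genericG, ← pow_add, show r + (n - (s + 1) * r) = n - s * r by rw [Nat.succ_mul]; omega] at h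
  simpa using h

theorem degree_quot_le (s : ℕ) : (quot n r s).degree ≤ (n - s * r : ℕ) := by
  rw [← natDegree_quot]
  exact degree_le_natDegree

/-- Infinitesimally, g, H_s and the first `s` digits form a coordinate system: the product rule on
H_s = R_s + g H_{s+1} passes from one `s` to the next. -/
theorem exists_vectorField {s : ℕ} (hs : s * r ≤ n) {u v : (HolGerm (Fin n ⊕ Fin r))[X]}
    {ρ : ℕ → (HolGerm (Fin n ⊕ Fin r))[X]} (hu : u.degree < r) (hv : v.degree < (n - s * r : ℕ))
    (hρ : ∀ i, (ρ i).degree < r) :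
    ∃ c, coeffDeriv c (genericG n r) = u ∧ coeffDeriv c (quot n r s) = v ∧
      ∀ i < s, coeffDeriv c (rem n r i) = ρ i := by
  induction s generalizing v with
  | zero =>
    rw [zero_mul, Nat.sub_zero] at hv
    refine ⟨Sum.elim (fun i => v.coeff i) (fun j => u.coeff j), ?_, ?_, by simp⟩
    · rw [genericG, coeffDeriv_genericMonic]
      exact sum_fin_C_coeff_mul_X_pow hu
    · rw [quot, genericF, coeffDeriv_genericMonic]
      exact sum_fin_C_coeff_mul_X_pow hv
  | succ s ih =>
    have hs' : s * r + r ≤ n := by rwa [← Nat.succ_mul]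
    have hsub : n - s * r = r + (n - (s + 1) * r) := by rw [Nat.succ_mul]; omega
    obtain ⟨c, hG, hH, hR⟩ := ih (by omega)
      -- The derivative that H_s must have if R_s, g, H_{s+1} go to `ρ s`, `u`, `v`.
      (v := ρ s + (u * quot n r (s + 1) + v * genericG n r)) (by
        rw [hsub]
        refine (degree_add_le _ _).trans_lt (max_lt ((hρ s).trans_le ?_)
          ((degree_add_le _ _).trans_lt (max_lt ?_ ?_)))
        · exact_mod_cast Nat.le_add_right _ _
        · exact degree_mul_lt_add hu (degree_quot_le n r (s + 1))
        · rw [add_comm r]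
          exact degree_mul_lt_add hv (degree_genericG n r).le)
    -- Two divisions of the same polynomial by g; uniqueness matches both quotients and remainders.
    have h1 := div_modByMonic_unique (f := ρ s + genericG n r * v) v (ρ s) (genericG_monic n r)
      ⟨rfl, by rw [degree_genericG]; exact hρ s⟩
    have h2 := div_modByMonic_unique (f := ρ s + genericG n r * v)
      (coeffDeriv c (quot n r (s + 1))) (coeffDeriv c (rem n r s)) (genericG_monic n r) ⟨by
        rw [quot_eq, map_add, Derivation.leibniz, hG, smul_eq_mul, smul_eq_mul] at hH
        linear_combination hH, by
        rw [degree_genericG]; exact degree_coeffDeriv_lt c (degree_rem_lt n r s)⟩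
    refine ⟨c, hG, h2.1.symm.trans h1.1, fun i hi => ?_⟩
    rcases Nat.lt_succ_iff_lt_or_eq.1 hi with hi | rfl
    · exact hR i hi
    · exact h2.2.symm.trans h1.2

end EuclideanData

/-! ### Computation of the successive critical extensions -/

section CriticalExtensions

variable (n r : ℕ)

/-- The derivative of `g ^ (s + 1)` times the `s`-th quotient along a vector field that takes `g`
to `u` and that quotient to `v`. -/
def derivPoly (s : ℕ) (u v : (HolGerm (Fin n ⊕ Fin r))[X]) : (HolGerm (Fin n ⊕ Fin r))[X] :=
  genericG n r ^ s * (((s + 1 : ℕ) : (HolGerm (Fin n ⊕ Fin r))[X]) * u * quot n r s +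
    genericG n r * v)

variable {n r}

theorem coeffDeriv_pow_mul_quot {s : ℕ} {c : Fin n ⊕ Fin r → HolGerm (Fin n ⊕ Fin r)}
    {u v : (HolGerm (Fin n ⊕ Fin r))[X]} (hu : coeffDeriv c (genericG n r) = u)
    (hv : coeffDeriv c (quot n r s) = v) :
    coeffDeriv c (genericG n r ^ (s + 1) * quot n r s) = derivPoly n r s u v := by
  rw [coeffDeriv_pow_mul, hu, hv, derivPoly]

theorem map_derivPoly {s : ℕ} (hs : s * r ≤ n) (u v : (HolGerm (Fin n ⊕ Fin r))[X]) :
    (derivPoly n r s u v).map (evalHom _) = X ^ (r * s) * (((s + 1 : ℕ) : ℂ[X]) *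
      u.map (evalHom _) * X ^ (n - s * r) + X ^ r * v.map (evalHom _)) := by
  simp only [derivPoly, Polynomial.map_mul, Polynomial.map_add, Polynomial.map_pow,
    Polynomial.map_natCast, map_genericG, map_quot n r hs, pow_mul]

theorem evalHom_coeff {ι : Type} [Fintype ι] (P : (HolGerm ι)[X]) (l : ℕ) :
    evalHom ι (P.coeff l) = (P.map (evalHom ι)).coeff l :=
  (coeff_map _ l).symm

theorem rem_coeff_mem {s i : ℕ} (hi : i < s) (l : ℕ) : (rem n r i).coeff l ∈ digitIdeal n r s :=
  Ideal.subset_span (Or.inl ⟨i, hi, l, rfl⟩)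

theorem pow_mul_quot_coeff_mem (s : ℕ) {l : ℕ} (hl : l < n + r) :
    (genericG n r ^ (s + 1) * quot n r s).coeff l ∈ digitIdeal n r s :=
  Ideal.subset_span (Or.inr ⟨l, hl, rfl⟩)

theorem digitIdeal_le {s : ℕ} {K : Ideal (HolGerm (Fin n ⊕ Fin r))}
    (h1 : ∀ i < s, ∀ l, (rem n r i).coeff l ∈ K)
    (h2 : ∀ l < n + r, (genericG n r ^ (s + 1) * quot n r s).coeff l ∈ K) :
    digitIdeal n r s ≤ K := by
  refine Ideal.span_le.2 ?_
  rintro _ (⟨i, hi, l, rfl⟩ | ⟨l, hl, rfl⟩)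
  exacts [h1 i hi l, h2 l hl]

theorem succ_mul_le_of_lt {s i : ℕ} (hi : i < s) (hs : s * r ≤ n) : (i + 1) * r ≤ n :=
  (Nat.mul_le_mul_right r hi).trans hs

/-- At the origin the digits vanish and g^(s+1) H_s becomes X^(n+r), whose lower coefficients are
zero. -/
theorem digitIdeal_le_ker {s : ℕ} (hs : s * r ≤ n) :
    digitIdeal n r s ≤ RingHom.ker (evalHom _) := by
  refine digitIdeal_le (fun i hi l => ?_) fun l hl => ?_
  · rw [RingHom.mem_ker, evalHom_coeff, map_rem n r (succ_mul_le_of_lt hi hs), coeff_zero]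
  · rw [RingHom.mem_ker, evalHom_coeff, Polynomial.map_mul, Polynomial.map_pow, map_genericG,
      map_quot n r hs, ← pow_mul, ← pow_add, coeff_X_pow, if_neg]
    rw [mul_comm, Nat.succ_mul]
    omega

theorem digitIdeal_ne_top {s : ℕ} (hs : s * r ≤ n) : digitIdeal n r s ≠ ⊤ := by
  intro h
  have : (1 : HolGerm (Fin n ⊕ Fin r)) ∈ RingHom.ker (evalHom _) :=
    digitIdeal_le_ker hs (h ▸ trivial)
  simp at this

/-- A derivation maps an ideal into any larger ideal that contains the images of generators. -/
theorem derivation_mem_of_span {A : Type*} [CommRing A] (D : Derivation ℤ A A) {S : Set A}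
    {K : Ideal A} (hSK : Ideal.span S ≤ K) (hD : ∀ g ∈ S, D g ∈ K) {g : A}
    (hg : g ∈ Ideal.span S) : D g ∈ K := by
  induction hg using Submodule.span_induction with
  | mem x hx => exact hD x hx
  | zero => simp
  | add x y _ _ hx hy => rw [map_add]; exact K.add_mem hx hy
  | smul a x hxS hx =>
    rw [smul_eq_mul, Derivation.leibniz]
    exact K.add_mem (K.mul_mem_left _ hx) (K.mul_mem_right _ (hSK hxS))

theorem vectorField_mem {s : ℕ} {c : Fin n ⊕ Fin r → HolGerm (Fin n ⊕ Fin r)}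
    {K : Ideal (HolGerm (Fin n ⊕ Fin r))} (hK : digitIdeal n r s ≤ K)
    (hR : ∀ i < s, coeffDeriv c (rem n r i) = 0)
    (hP : ∀ l, (coeffDeriv c (genericG n r ^ (s + 1) * quot n r s)).coeff l ∈ K)
    {g : HolGerm (Fin n ⊕ Fin r)} (hg : g ∈ digitIdeal n r s) : vectorField c g ∈ K := by
  refine derivation_mem_of_span _ hK ?_ hg
  rintro _ (⟨i, hi, l, rfl⟩ | ⟨l, -, rfl⟩)
  · rw [← coeff_coeffDeriv, hR i hi]
    simp
  · exact hP l

/-- Reduces a frame to polynomial data: pairs `u`, `v` whose derivative at the origin is a monomial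
`X ^ p l` give normal fields, and pairs `u'`, `v'` with zero derivative there give tangent ones. The
digits supply the other `s * r` normal directions. -/
theorem exists_isFrame {s d e : ℕ} (hs : s * r ≤ n) (hde : d + e = n - s * r + r)
    {u v : Fin d → (HolGerm (Fin n ⊕ Fin r))[X]} (hu : ∀ l, (u l).degree < r)
    (hv : ∀ l, (v l).degree < (n - s * r : ℕ)) {p : Fin d → ℕ} (hp : ∀ l, p l < n + r)
    (hpi : Function.Injective p)
    (huv : ∀ l, (derivPoly n r s (u l) (v l)).map (evalHom _) = X ^ p l)
    {u' v' : Fin e → (HolGerm (Fin n ⊕ Fin r))[X]} (hu' : ∀ a, (u' a).degree < r)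
    (hv' : ∀ a, (v' a).degree < (n - s * r : ℕ))
    (huv' : ∀ a, (derivPoly n r s (u' a) (v' a)).map (evalHom _) = 0)
    {y : Fin e → HolGerm (Fin n ⊕ Fin r)}
    (hy : ∀ a b c, coeffDeriv c (genericG n r) = u' a → coeffDeriv c (quot n r s) = v' a →
      evalHom _ (vectorField c (y b)) = if a = b then 1 else 0) :
    ∃ φ θ, IsFrame (digitIdeal n r s) φ θ
      (Sum.elim (fun i : Fin s × Fin r => (rem n r i.1).coeff i.2)
        fun l => (genericG n r ^ (s + 1) * quot n r s).coeff (p l)) y ∧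
      ∀ a, coeffDeriv (θ a) (genericG n r) = u' a ∧ coeffDeriv (θ a) (quot n r s) = v' a ∧
        ∀ i < s, coeffDeriv (θ a) (rem n r i) = 0 := by
  have h0 (k : ℕ) : (0 : (HolGerm (Fin n ⊕ Fin r))[X]).degree < k := by simp
  have hρ (i : Fin s × Fin r) (k : ℕ) :
      (if k = i.1 then (X ^ (i.2 : ℕ) : (HolGerm (Fin n ⊕ Fin r))[X]) else 0).degree < r := by
    split_ifs
    · rw [degree_X_pow]
      exact_mod_cast i.2.2
    · exact h0 r
  choose φ₁ hφ₁G hφ₁H hφ₁R using fun i => exists_vectorField n r hs (h0 r) (h0 _) (hρ i)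
  choose φ₂ hφ₂G hφ₂H hφ₂R using fun l =>
    exists_vectorField n r hs (ρ := fun _ => 0) (hu l) (hv l) fun _ => h0 r
  choose θ hθG hθH hθR using fun a =>
    exists_vectorField n r hs (ρ := fun _ => 0) (hu' a) (hv' a) fun _ => h0 r
  refine ⟨Sum.elim φ₁ φ₂, θ, ⟨?_, ?_, ?_, ?_, fun a b => hy a b _ (hθG a) (hθH a)⟩,
    fun a => ⟨hθG a, hθH a, hθR a⟩⟩
  · simp only [Fintype.card_sum, Fintype.card_prod, Fintype.card_fin]
    omega
  · rintro (i | l)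
    exacts [rem_coeff_mem i.1.2 _, pow_mul_quot_coeff_mem s (hp l)]
  · rintro (i | l) (j | m)
    · simp only [Sum.elim_inl, ← coeff_coeffDeriv, hφ₁R i j.1 j.1.2, Sum.inl.injEq]
      by_cases h1 : j.1 = i.1
      · by_cases h2 : j.2 = i.2
        · simp [h1, h2, Prod.ext_iff]
        · simp [h1, coeff_X_pow, Fin.val_inj, h2, Prod.ext_iff, Ne.symm h2]
      · simp [Fin.val_inj, h1, Prod.ext_iff, Ne.symm h1]
    · simp [← coeff_coeffDeriv, coeffDeriv_pow_mul_quot (hφ₁G i) (hφ₁H i), derivPoly]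
    · simp [← coeff_coeffDeriv, hφ₂R l j.1 j.1.2]
    · simp only [Sum.elim_inr, ← coeff_coeffDeriv, coeffDeriv_pow_mul_quot (hφ₂G l) (hφ₂H l),
        evalHom_coeff, huv, coeff_X_pow, Sum.inr.injEq, hpi.eq_iff, eq_comm]
  · intro a g hg
    rw [← RingHom.mem_ker]
    refine vectorField_mem (digitIdeal_le_ker hs) (hθR a) (fun l => ?_) hg
    rw [coeffDeriv_pow_mul_quot (hθG a) (hθH a), RingHom.mem_ker, evalHom_coeff, huv', coeff_zero]

theorem coeff_genericMonic {ι : Type} [Fintype ι] {k : ℕ} (e : Fin k → ι) (b : Fin k) :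
    (genericMonic e).coeff b = coordGerm (e b) := by
  simp [genericMonic, coeff_X_pow, b.2.ne, Fin.val_inj]

theorem coordGerm_inr_eq (b : Fin r) :
    (coordGerm (Sum.inr b) : HolGerm (Fin n ⊕ Fin r)) = (genericG n r).coeff b :=
  (coeff_genericMonic _ b).symm

/-- The products g^(s+1) H_s and g^(s+2) H_{s+1} differ by g^(s+1) R_s, whose coefficients lie in
the ideal of those of R_s. -/
theorem digitIdeal_sup (s : ℕ) :
    digitIdeal n r s ⊔ Ideal.span (Set.range (rem n r s).coeff) = digitIdeal n r (s + 1) := by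
  have hR (K : Ideal (HolGerm (Fin n ⊕ Fin r))) (hK : ∀ l, (rem n r s).coeff l ∈ K) (l : ℕ) :
      (genericG n r ^ (s + 1) * quot n r s).coeff l -
        (genericG n r ^ (s + 1 + 1) * quot n r (s + 1)).coeff l ∈ K := by
    rw [← coeff_sub, quot_eq, show genericG n r ^ (s + 1) * (rem n r s + genericG n r *
      quot n r (s + 1)) - genericG n r ^ (s + 1 + 1) * quot n r (s + 1) =
      genericG n r ^ (s + 1) * rem n r s by ring]
    refine map_mk_eq_zero_iff.1 ?_ l
    rw [Polynomial.map_mul, map_mk_eq_zero_iff.2 hK, mul_zero]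
  apply le_antisymm
  · refine sup_le (digitIdeal_le (fun i hi l => rem_coeff_mem (hi.trans s.lt_succ_self) l)
      fun l hl => ?_) (Ideal.span_le.2 ?_)
    · exact (Submodule.sub_mem_iff_left _ (pow_mul_quot_coeff_mem (s + 1) hl)).1
        (hR _ (rem_coeff_mem s.lt_succ_self) l)
    · rintro _ ⟨l, rfl⟩
      exact rem_coeff_mem s.lt_succ_self l
  · have hmem (l : ℕ) : (rem n r s).coeff l ∈
        digitIdeal n r s ⊔ Ideal.span (Set.range (rem n r s).coeff) :=
      Ideal.mem_sup_right (Ideal.subset_span ⟨l, rfl⟩)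
    refine digitIdeal_le (fun i hi l => ?_) fun l hl => ?_
    · rcases Nat.lt_succ_iff_lt_or_eq.1 hi with hi | rfl
      · exact Ideal.mem_sup_left (rem_coeff_mem hi l)
      · exact hmem l
    · exact (Submodule.sub_mem_iff_right _ (Ideal.mem_sup_left (pow_mul_quot_coeff_mem s hl))).1
        (hR _ hmem l)

theorem degree_X_pow_lt {ι : Type} [Fintype ι] {a k : ℕ} (h : a < k) :
    (X ^ a : (HolGerm ι)[X]).degree < k := by
  rw [degree_X_pow]
  exact_mod_cast h

theorem criticalExt_digitIdeal (hr : 0 < r) {s : ℕ} (hs : (s + 1) * r ≤ n) :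
    criticalExt (digitIdeal n r s) = digitIdeal n r (s + 1) := by
  have hs' : s * r + r ≤ n := by rwa [← Nat.succ_mul]
  have hsn : s * r ≤ n := by omega
  -- Chosen so that `g * v'` removes the quotient part of (s+1) X^a H_s, leaving only its remainder
  -- modulo g.
  let v' : Fin r → (HolGerm (Fin n ⊕ Fin r))[X] := fun a =>
    -(((s + 1 : ℕ) : (HolGerm (Fin n ⊕ Fin r))[X]) * ((X ^ (a : ℕ) * quot n r s) /ₘ genericG n r))
  have hv' (a) : (v' a).degree < (n - s * r : ℕ) := by
    rw [degree_neg, ← nsmul_eq_mul]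
    refine (degree_smul_le _ _).trans_lt ?_
    by_cases hz : (X ^ (a : ℕ) * quot n r s) /ₘ genericG n r = 0
    · simp [hz]
    rw [degree_eq_natDegree hz, Nat.cast_lt, natDegree_divByMonic _ (genericG_monic n r),
      natDegree_genericG]
    have := natDegree_mul_le (p := (X ^ (a : ℕ) : (HolGerm (Fin n ⊕ Fin r))[X]))
      (q := quot n r s)
    rw [natDegree_X_pow, natDegree_quot] at this
    omega
  have hθ (a : Fin r) : derivPoly n r s (X ^ (a : ℕ)) (v' a) =
      ((s + 1 : ℕ) : (HolGerm (Fin n ⊕ Fin r))[X]) * (genericG n r ^ s *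
        ((X ^ (a : ℕ) * quot n r s) %ₘ genericG n r)) := by
    rw [modByMonic_eq_sub_mul_div, derivPoly]
    ring
  have hmod (a : Fin r) : (X ^ (a : ℕ) * quot n r s) %ₘ genericG n r =
      (X ^ (a : ℕ) * rem n r s) %ₘ genericG n r := by
    rw [← sub_eq_zero, ← sub_modByMonic, modByMonic_eq_zero_iff_dvd (genericG_monic n r),
      quot_eq]
    exact ⟨X ^ (a : ℕ) * quot n r (s + 1), by ring⟩
  obtain ⟨φ, θ, hF, hθ'⟩ := exists_isFrame (s := s) (d := n - s * r) (e := r) hsn rfl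
    (u := fun _ => 0) (v := fun l => X ^ (l : ℕ)) (by simp) (fun l => degree_X_pow_lt l.2)
    (p := fun l => (s + 1) * r + l) (fun l => by rw [Nat.succ_mul]; omega)
    (fun l m h => Fin.ext (Nat.add_left_cancel h))
    (fun l => by
      rw [map_derivPoly hsn]
      simp only [Polynomial.map_zero, mul_zero, zero_mul, zero_add, Polynomial.map_pow, map_X]
      ring)
    (u' := fun a => X ^ (a : ℕ)) (v' := v') (fun a => degree_X_pow_lt a.2) hv'
    (fun a => by
      rw [hθ, hmod, Polynomial.map_mul, Polynomial.map_mul,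
        map_modByMonic _ (genericG_monic n r), Polynomial.map_mul, map_rem n r hs]
      simp)
    (y := fun b => coordGerm (Sum.inr b)) (fun a b c hG _ => by
      rw [coordGerm_inr_eq, ← coeff_coeffDeriv, hG, coeff_X_pow]
      simp [Fin.val_inj, eq_comm, apply_ite])
  have hder (a : Fin r) := coeffDeriv_pow_mul_quot (hθ' a).1 (hθ' a).2.1
  rw [criticalExt, hF.criticalOrder_eq (digitIdeal_ne_top hsn), hF.jacobianExt_eq, ← digitIdeal_sup]
  · apply le_antisymm
    · refine sup_le le_sup_left (Ideal.span_le.2 ?_)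
      rintro _ ⟨a, g, hg, rfl⟩
      refine vectorField_mem le_sup_left (hθ' a).2.2 (map_mk_eq_zero_iff.1 ?_) hg
      have hR : (rem n r s).map (Ideal.Quotient.mk
          (digitIdeal n r s ⊔ Ideal.span (Set.range (rem n r s).coeff))) = 0 :=
        map_mk_eq_zero_iff.2 fun l => Ideal.mem_sup_right (Ideal.subset_span ⟨l, rfl⟩)
      rw [hder, hθ, hmod, Polynomial.map_mul, Polynomial.map_mul,
        map_modByMonic _ (genericG_monic n r), Polynomial.map_mul, hR, mul_zero, zero_modByMonic,
        mul_zero, mul_zero]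
    · refine sup_le le_sup_left (Ideal.span_le.2 ?_)
      rintro _ ⟨l, rfl⟩
      set K := digitIdeal n r s ⊔
        Ideal.span {d | ∃ a, ∃ g ∈ digitIdeal n r s, d = vectorField (θ a) g}
      refine map_mk_eq_zero_iff.1 ?_ l
      -- Powers of a monic polynomial can be cancelled over any quotient ring, so it suffices to
      -- treat g^s R_s.
      have hGm := (genericG_monic n r).map (Ideal.Quotient.mk K)
      rw [← (hGm.pow s).mul_right_eq_zero_iff, ← Polynomial.map_pow, ← Polynomial.map_mul,
        map_mk_eq_zero_iff]
      intro j
      by_cases hj : j < n + r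
      · rw [← Ideal.unit_mul_mem_iff_mem K (isUnit_natCast_succ s)]
        have h1 : vectorField (θ ⟨0, hr⟩) ((genericG n r ^ (s + 1) * quot n r s).coeff j) ∈ K :=
          Ideal.mem_sup_right (Ideal.subset_span
            ⟨⟨0, hr⟩, _, pow_mul_quot_coeff_mem s hj, rfl⟩)
        rw [← coeff_coeffDeriv, hder, hθ, ← nsmul_eq_mul, coeff_smul, nsmul_eq_mul, pow_zero,
          one_mul] at h1
        exact h1
      · have hdeg : (rem n r s * genericG n r ^ s).degree < (r + s * r : ℕ) :=
          degree_mul_lt_add (degree_rem_lt n r s) (by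
            refine (degree_pow_le _ _).trans ?_
            rw [degree_genericG, nsmul_eq_mul]
            exact_mod_cast le_rfl)
        rw [mul_comm, (degree_lt_iff_coeff_zero _ _).1 hdeg j (by omega)]
        exact K.zero_mem
  · rintro a (i | l)
    · rw [Sum.elim_inl, ← coeff_coeffDeriv, (hθ' a).2.2 _ i.1.2, coeff_zero]
    · rw [Sum.elim_inr, ← coeff_coeffDeriv, hder, hθ]
      -- The tangent derivative has degree below (s+1) r, while the chosen generators are the
      -- coefficients of index at least (s+1) r; hence they are killed identically.
      have hdeg : ((X ^ (a : ℕ) * quot n r s) %ₘ genericG n r *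
          genericG n r ^ s).degree < (r + s * r : ℕ) :=
        degree_mul_lt_add ((degree_modByMonic_lt _ (genericG_monic n r)).trans_eq
          (degree_genericG n r)) (by
            refine (degree_pow_le _ _).trans ?_
            rw [degree_genericG, nsmul_eq_mul]
            exact_mod_cast le_rfl)
      rw [← nsmul_eq_mul, coeff_smul, mul_comm, (degree_lt_iff_coeff_zero _ _).1 hdeg _
        (by rw [Nat.succ_mul]; omega), smul_zero]

theorem iterate_criticalExt_mulIdeal (hr : 0 < r) {s : ℕ} (hs : s * r ≤ n) :
    criticalExt^[s] (mulIdeal n r) = digitIdeal n r s := by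
  induction s with
  | zero => exact mulIdeal_eq_digitIdeal n r
  | succ s ih =>
    rw [Function.iterate_succ_apply', ih ((Nat.mul_le_mul_right r s.le_succ).trans hs),
      criticalExt_digitIdeal hr hs]

/-- Now `u` alone reaches the `r` monomials from X^(rs+t) to X^(rs+t+r-1). Each of the `t` choices v
= X^a is compensated by u = -X^(r-t+a)/(s+1), of degree below `r`, giving the kernel. -/
theorem exists_isFrame_of_remainder {s t : ℕ} (hn : n = s * r + t) (ht : t < r) :
    ∃ (φ : (Fin s × Fin r) ⊕ Fin r → _) (θ : Fin t → _) (f : _) (y : _),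
      IsFrame (digitIdeal n r s) φ θ f y := by
  have hs : s * r ≤ n := by omega
  have hsub : n - s * r = t := by omega
  obtain ⟨w, hw⟩ := (isUnit_natCast_succ (ι := Fin n ⊕ Fin r) s).exists_left_inv
  have hw' : ((s + 1 : ℕ) : ℂ[X]) * C (evalHom _ w) = 1 := by
    have := congrArg (fun a => C (evalHom _ a)) hw
    simpa [mul_comm] using this
  have hC {a : ℕ} (ha : a < r) : (C w * X ^ a : (HolGerm (Fin n ⊕ Fin r))[X]).degree < r :=
    (degree_C_mul_X_pow_le _ _).trans_lt (by exact_mod_cast ha)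
  obtain ⟨φ, θ, hF, -⟩ := exists_isFrame (s := s) (d := r) (e := t) hs (by omega)
    (u := fun l => C w * X ^ (l : ℕ)) (v := fun _ => 0) (fun l => hC l.2) (by simp)
    (p := fun l => r * s + l + t) (fun l => by rw [mul_comm]; omega)
    (fun l m h => Fin.ext (by simpa using h))
    (fun l => by
      rw [map_derivPoly hs, hsub]
      simp only [Polynomial.map_zero, mul_zero, add_zero, Polynomial.map_pow, map_X,
        Polynomial.map_mul, map_C]
      linear_combination X ^ (r * s) * X ^ (l : ℕ) * X ^ t * hw')
    (u' := fun a => -(C w * X ^ (r - t + a))) (v' := fun a => X ^ (a : ℕ))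
    (fun a => by rw [degree_neg]; exact hC (by omega))
    (fun a => degree_X_pow_lt (by omega))
    (fun a => by
      rw [map_derivPoly hs, hsub]
      have hX : (X ^ r : ℂ[X]) = X ^ (r - t) * X ^ t := by
        rw [← pow_add, Nat.sub_add_cancel ht.le]
      simp only [Polynomial.map_neg, Polynomial.map_pow, map_X, Polynomial.map_mul, map_C, hX]
      linear_combination -X ^ (r * s) * X ^ (r - t) * X ^ (a : ℕ) * X ^ t * hw')
    (y := fun b => (quot n r s).coeff b) (fun a b c _ hH => by
      rw [← coeff_coeffDeriv, hH, coeff_X_pow]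
      simp [Fin.val_inj, eq_comm, apply_ite])
  exact ⟨φ, θ, _, _, hF⟩

end CriticalExtensions

end ThomBoardman
end

theorem proposition3p8 (n r q₁ r₁ : ℕ) (hr : 0 < r) (hrn : r ≤ n)
    (hdiv : n = q₁ * r + r₁) (hr₁ : r₁ < r) :
    ThomBoardman.TB (ThomBoardman.mulIdeal n r) q₁ = r₁ ∧
    ThomBoardman.jacobianRankAtZero
      (ThomBoardman.criticalExt^[q₁] (ThomBoardman.mulIdeal n r)) = n + r - r₁ := by
  have hs : q₁ * r ≤ n := by omega
  obtain ⟨φ, θ, f, y, hF⟩ := ThomBoardman.exists_isFrame_of_remainder hdiv hr₁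
  rw [ThomBoardman.TB, ThomBoardman.iterate_criticalExt_mulIdeal hr hs]
  refine ⟨?_, ?_⟩
  · rw [hF.criticalIndex_eq (ThomBoardman.digitIdeal_ne_top hs), Fintype.card_fin]
  · rw [hF.jacobianRankAtZero_eq]
    simp only [Fintype.card_sum, Fintype.card_prod, Fintype.card_fin]
    omega
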